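/- Let $(M,g)$ be a smooth pseudo-Riemannian manifold of dimension $n\ge 3$ with Levi-Civita connection $\nabla$, curvature tensor $\mathcal R(X,Y)Z=\nabla_Y\nabla_XZ-\nabla_X\nabla_YZ+\nabla_{[X,Y]}Z$, Ricci tensor $\mathcal R_{jl}=g^{ik}\mathcal R_{ijkl}$, where $\mathcal R(X,Y,Z,V)=g(\mathcal R(X,Y)Z,V)$, and scalar curvature $\tau=g^{ij}\mathcal R_{ij}$. Put $\mathcal G(X,Y)Z=g(X,Z)Y-g(Y,Z)X$ and let $\mathcal C=\mathcal R-\frac{\tau}{n(n-1)}\mathcal G$ be the concircular curvature tensor. For $(1,3)$-tensor fields $A,T$ let $A\cdot T$ be the tensor field obtained by letting the endomorphism $A(X,Y)$ act on $T$ as a derivation: $$\big((A\cdot T)(X,Y)\big)(U,V)W=A(X,Y)\big(T(U,V)W\big)-T(A(X,Y)U,V)W-T(U,A(X,Y)V)W-T(U,V)\big(A(X,Y)W\big).$$ Call $M$ semi-symmetric if $\mathcal R\cdot\mathcal R=0$, pseudo-symmetric if $\mathcal R\cdot\mathcal R=\frac{\tau}{n(n-1)}\,\mathcal G\cdot\mathcal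 R$, and call $\mathcal C$ semi-symmetric if $\mathcal R\cdot\mathcal C=0$. Then: 1. $M$ is pseudo-symmetric if and only if $\mathcal C\cdot\mathcal C=0$; 2. $\mathcal C$ is semi-symmetric if and only if $M$ is semi-symmetric; 3. $M$ is pseudo-symmetric if and only if $\mathcal C\cdot\mathcal R=0$. -/

import Mathlib

open scoped Manifold ContDiff

noncomputable section

/-! ## Levi-Civita connection and curvature in a coordinate domain

Here `h : E → E →L[ℝ] E →L[ℝ] ℝ` is the coordinate expression of a metric, and vector fields on
the coordinate domain are maps `E → E`. -/

section Coordinates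

variable {E : Type*} [NormedAddCommGroup E] [NormedSpace ℝ E]

/-- The Christoffel symbols `Γ_y(u, v)` of the metric `h`: the vector determined by
`2 h_y(Γ_y(u, v), w) = (∂_u h)(v, w) + (∂_v h)(u, w) - (∂_w h)(u, v)` for all `w`. -/
def coordChristoffel (h : E → E →L[ℝ] E →L[ℝ] ℝ) (y u v : E) : E :=
  (h y).inverse ((1 / 2 : ℝ) •
    (fderiv ℝ h y u v + fderiv ℝ h y v u - ((fderiv ℝ h y).flip u).flip v))

/-- The Levi-Civita connection `∇_X Y` of the metric `h`. -/
def coordNabla (h : E → E →L[ℝ] E →L[ℝ] ℝ) (X Y : E → E) : E → E :=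
  fun y => fderiv ℝ Y y (X y) + coordChristoffel h y (X y) (Y y)

/-- The Riemann curvature operator
`R(X, Y)Z = ∇_Y ∇_X Z - ∇_X ∇_Y Z + ∇_{[X, Y]} Z` of the metric `h`. -/
def coordCurvature (h : E → E →L[ℝ] E →L[ℝ] ℝ) (X Y Z : E → E) : E → E :=
  coordNabla h Y (coordNabla h X Z) - coordNabla h X (coordNabla h Y Z)
    + coordNabla h (VectorField.lieBracket ℝ X Y) Z

end Coordinates

/-! ## Pseudo-Riemannian manifolds -/

variable {E : Type*} [NormedAddCommGroup E] [NormedSpace ℝ E] [FiniteDimensional ℝ E]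
  {M : Type*} [TopologicalSpace M] [ChartedSpace E M] [IsManifold 𝓘(ℝ, E) ∞ M]

variable (E M) in
/-- A pseudo-Riemannian metric: a smooth symmetric nondegenerate `(0,2)`-tensor field. -/
structure PseudoRiemannianMetric where
  val : ∀ x : M, TangentSpace 𝓘(ℝ, E) x →L[ℝ] TangentSpace 𝓘(ℝ, E) x →L[ℝ] ℝ
  symm : ∀ (x : M) (v w : TangentSpace 𝓘(ℝ, E) x), val x v w = val x w v
  nondegenerate : ∀ (x : M) (v : TangentSpace 𝓘(ℝ, E) x), (∀ w, val x v w = 0) → v = 0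
  contMDiff : ContMDiff 𝓘(ℝ, E) (𝓘(ℝ, E).prod 𝓘(ℝ, E →L[ℝ] E →L[ℝ] ℝ)) ∞
    (fun x => Bundle.TotalSpace.mk' (E →L[ℝ] E →L[ℝ] ℝ) x (val x))

variable (E M) in
/-- Tensor fields of type `(1,3)`, written `T x X Y Z = T(X, Y)Z`. -/
abbrev TensorField13 :=
  ∀ x : M, TangentSpace 𝓘(ℝ, E) x → TangentSpace 𝓘(ℝ, E) x → TangentSpace 𝓘(ℝ, E) x →
    TangentSpace 𝓘(ℝ, E) x

variable (E M) in
/-- Tensor fields of type `(1,5)`. -/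
abbrev TensorField15 :=
  ∀ x : M, TangentSpace 𝓘(ℝ, E) x → TangentSpace 𝓘(ℝ, E) x → TangentSpace 𝓘(ℝ, E) x →
    TangentSpace 𝓘(ℝ, E) x → TangentSpace 𝓘(ℝ, E) x → TangentSpace 𝓘(ℝ, E) x

/-- `A · T`: the endomorphism `A(X, Y)` acts on `T` as a derivation of the tensor algebra,
`((A · T)(X, Y))(U, V)W
  = A(X, Y)(T(U, V)W) - T(A(X, Y)U, V)W - T(U, A(X, Y)V)W - T(U, V)(A(X, Y)W)`. -/
def derivAction (A T : TensorField13 E M) : TensorField15 E M :=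
  fun x X Y U V W =>
    A x X Y (T x U V W) - T x (A x X Y U) V W - T x U (A x X Y V) W - T x U V (A x X Y W)

namespace PseudoRiemannianMetric

variable (g : PseudoRiemannianMetric E M)

/-- The coordinate expression of `g` in the chart `φ` at `p`: the pull-back of `g` by `φ⁻¹`,
`h_y(u, v) = g_{φ⁻¹(y)}(d(φ⁻¹)_y u, d(φ⁻¹)_y v)`. Each tangent space of `M` has `E` as its
underlying topological vector space. -/
def inChart (p : M) (y : E) : E →L[ℝ] E →L[ℝ] ℝ :=
  let B : E →L[ℝ] E →L[ℝ] ℝ := g.val ((extChartAt 𝓘(ℝ, E) p).symm y)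
  let D : E →L[ℝ] E := mfderiv 𝓘(ℝ, E) 𝓘(ℝ, E) (extChartAt 𝓘(ℝ, E) p).symm y
  B.bilinearComp D D

/-- The Riemann curvature tensor `R(X, Y)Z` at `x`, computed in the chart `φ` at `x`: the tangent
vectors are moved to the coordinate domain by `dφ`, extended to constant vector fields there,
and the result is moved back by the derivative of `φ⁻¹`. -/
def curvature : TensorField13 E M := fun x X Y Z =>
  let φ := extChartAt 𝓘(ℝ, E) x
  let D : TangentSpace 𝓘(ℝ, E) x →L[ℝ] E := mfderiv 𝓘(ℝ, E) 𝓘(ℝ, E) φ x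
  let D' : E →L[ℝ] E := mfderiv 𝓘(ℝ, E) 𝓘(ℝ, E) φ.symm (φ x)
  D' (coordCurvature (g.inChart x) (fun _ => D X) (fun _ => D Y) (fun _ => D Z) (φ x))

/-- The basis of `T_x M` in which contractions are computed. -/
def tangentBasis (x : M) :
    Module.Basis (Fin (Module.finrank ℝ E)) ℝ (TangentSpace 𝓘(ℝ, E) x) :=
  Module.finBasis ℝ E

/-- The matrix `(g_{ij})` at `x`. -/
def gram (x : M) : Matrix (Fin (Module.finrank ℝ E)) (Fin (Module.finrank ℝ E)) ℝ :=
  Matrix.of fun i j => g.val x (tangentBasis x i) (tangentBasis x j)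

/-- The metric contraction `g^{ij} B_{ij}` of a bilinear form on `T_x M`. -/
def contract (x : M) (B : TangentSpace 𝓘(ℝ, E) x → TangentSpace 𝓘(ℝ, E) x → ℝ) : ℝ :=
  ∑ i, ∑ j, (g.gram x)⁻¹ i j * B (tangentBasis x i) (tangentBasis x j)

/-- The Ricci tensor `R_{jl} = g^{ik} R_{ijkl}`, where `R(X, Y, Z, V) = g(R(X, Y)Z, V)`. -/
def ricci (x : M) (Y V : TangentSpace 𝓘(ℝ, E) x) : ℝ :=
  g.contract x fun X Z => g.val x (g.curvature x X Y Z) V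

/-- The scalar curvature `τ = g^{ij} R_{ij}`. -/
def scalarCurvature (x : M) : ℝ := g.contract x (g.ricci x)

/-- The tensor `G = (1/2) g ∧ g`, i.e. `G(X, Y)Z = g(X, Z)Y - g(Y, Z)X`. -/
def G : TensorField13 E M := fun x X Y Z => g.val x X Z • Y - g.val x Y Z • X

/-- The function `τ / (n (n - 1))`, where `n = dim M`. -/
def kappa (x : M) : ℝ :=
  g.scalarCurvature x / ((Module.finrank ℝ E : ℝ) * ((Module.finrank ℝ E : ℝ) - 1))

/-- The concircular curvature tensor `C = R - τ / (n (n - 1)) G`. -/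
def concircular : TensorField13 E M := fun x X Y Z =>
  g.curvature x X Y Z - g.kappa x • g.G x X Y Z

/-- `M` is semi-symmetric: `R · R = 0`. -/
def IsSemiSymmetric : Prop := derivAction g.curvature g.curvature = 0

/-- The concircular curvature tensor is semi-symmetric: `R · C = 0`. -/
def IsConcircularSemiSymmetric : Prop := derivAction g.curvature g.concircular = 0

/-- `M` is pseudo-symmetric: `R · R = τ / (n (n - 1)) G · R`. -/
def IsPseudoSymmetric : Prop :=
  ∀ x : M, derivAction g.curvature g.curvature x = g.kappa x • derivAction g.G g.curvature x

end PseudoRiemannianMetric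

end

/-! ### Christoffel symbols and curvature of a metric in a coordinate domain -/

section Coordinates

set_option maxSynthPendingDepth 3

variable {E : Type*} [NormedAddCommGroup E] [NormedSpace ℝ E]

/-! The tensor G is built from g alone, so a derivation by any g-skew-adjoint endomorphism
annihilates it (`derivAction_G_eq_zero`). Both R(X, Y) and G(X, Y) are skew-adjoint, hence so is
C(X, Y). As A · T is linear in T, this gives R · C = R · R and C · C = C · R; as it is linear in A
for trilinear T, C · R = R · R - κ G · R. The three claims follow pointwise; κ enters only as a
scalar at each point, never through its value or its derivatives.

The analytic work is to show that the curvature, defined in a chart on constant fields, is trilinear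
(`isTrilinear_curvature`) and skew-adjoint (`curvature_skew`). Skewness is the Ricci identity for
the metric: differentiate ∇h = 0 once more and use the symmetry of the second derivative of h. -/

lemma isLinearMap_coordChristoffel_left (h : E → E →L[ℝ] E →L[ℝ] ℝ) (y v : E) :
    IsLinearMap ℝ (fun u => coordChristoffel h y u v) where
  map_add a b := by
    rw [coordChristoffel, coordChristoffel, coordChristoffel, ← map_add]
    congr 1
    ext w
    simp only [map_add, add_apply, sub_apply,
      smul_apply, ContinuousLinearMap.flip_apply, smul_eq_mul]
    ring
  map_smul c a := by
    rw [coordChristoffel, coordChristoffel, ← map_smul]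
    congr 1
    ext w
    simp only [map_smul, add_apply, sub_apply,
      smul_apply, ContinuousLinearMap.flip_apply, smul_eq_mul]
    ring

lemma coordChristoffel_apply_metric {h : E → E →L[ℝ] E →L[ℝ] ℝ} {y : E}
    (hinv : (h y).IsInvertible) (u v w : E) :
    h y (coordChristoffel h y u v) w =
      (1 / 2 : ℝ) * (fderiv ℝ h y u v w + fderiv ℝ h y v u w - fderiv ℝ h y w u v) := by
  rw [coordChristoffel, hinv.self_apply_inverse]
  simp

/-- For constant vector fields the curvature is expressed through the Christoffel symbols. -/
lemma coordCurvature_const (h : E → E →L[ℝ] E →L[ℝ] ℝ) (u v w y : E) :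
    coordCurvature h (fun _ => u) (fun _ => v) (fun _ => w) y =
      fderiv ℝ (fun z => coordChristoffel h z u w) y v
        + coordChristoffel h y v (coordChristoffel h y u w)
      - (fderiv ℝ (fun z => coordChristoffel h z v w) y u
        + coordChristoffel h y u (coordChristoffel h y v w)) := by
  -- Constant fields commute, so the bracket term reduces to Γ(0, w).
  have h0 : ∀ z w, coordChristoffel h z 0 w = 0 := fun z w =>
    (isLinearMap_coordChristoffel_left h z w).map_zero
  have hΓ : ∀ u w, coordNabla h (fun _ => u) (fun _ => w) = fun z => coordChristoffel h z u w := by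
    intro u w
    funext z
    simp [coordNabla]
  simp only [coordCurvature, hΓ, Pi.add_apply, Pi.sub_apply]
  simp [coordNabla, VectorField.lieBracket, h0]

/-- The metric is symmetric and invertible near `y`, and twice continuously differentiable
at `y`. -/
structure IsMetricNear (h : E → E →L[ℝ] E →L[ℝ] ℝ) (y : E) : Prop where
  symm : ∀ᶠ z in nhds y, ∀ u v, h z u v = h z v u
  isInvertible : ∀ᶠ z in nhds y, (h z).IsInvertible
  contDiffAt : ContDiffAt ℝ 2 h y

namespace IsMetricNear

variable {h : E → E →L[ℝ] E →L[ℝ] ℝ} {y : E}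

/-- The conditions are open, so pointwise identities for Γ hold on a neighbourhood and may be
differentiated at `y`. -/
lemma eventually_isMetricNear (H : IsMetricNear h y) : ∀ᶠ z in nhds y, IsMetricNear h z := by
  filter_upwards [H.symm.eventually_nhds, H.isInvertible.eventually_nhds,
    H.contDiffAt.eventually (by simp)] with z h₁ h₂ h₃
  exact ⟨h₁, h₂, h₃⟩

lemma differentiableAt (H : IsMetricNear h y) : DifferentiableAt ℝ h y :=
  H.contDiffAt.differentiableAt (by norm_num)

lemma fderiv_symm (H : IsMetricNear h y) (w u v : E) :
    fderiv ℝ h y w u v = fderiv ℝ h y w v u := by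
  have key : ∀ a b, fderiv ℝ (fun z => h z a b) y w = fderiv ℝ h y w a b := by
    intro a b
    rw [fderiv_clm_apply (H.differentiableAt.clm_apply (differentiableAt_const _))
      (differentiableAt_const _), fderiv_clm_apply H.differentiableAt (differentiableAt_const _)]
    simp
  rw [← key, ← key]
  have : (fun z => h z u v) =ᶠ[nhds y] fun z => h z v u := by
    filter_upwards [H.symm] with z hz using hz u v
  rw [this.fderiv_eq]

lemma coordChristoffel_symm (H : IsMetricNear h y) (u v : E) :
    coordChristoffel h y u v = coordChristoffel h y v u := by
  rw [coordChristoffel, coordChristoffel]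
  congr 1
  ext w
  have := H.fderiv_symm w u v
  simp only [add_apply, sub_apply,
      smul_apply, ContinuousLinearMap.flip_apply, smul_eq_mul, this]
  ring

lemma isLinearMap_coordChristoffel_right (H : IsMetricNear h y) (u : E) :
    IsLinearMap ℝ (coordChristoffel h y u) := by
  have : coordChristoffel h y u = fun v => coordChristoffel h y v u :=
    funext fun v => H.coordChristoffel_symm u v
  rw [this]
  exact isLinearMap_coordChristoffel_left h y u

/-- The Levi-Civita connection is compatible with the metric. -/
lemma fderiv_metric (H : IsMetricNear h y) (w u v : E) :
    fderiv ℝ h y w u v =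
      h y (coordChristoffel h y w u) v + h y u (coordChristoffel h y w v) := by
  have hinv := H.isInvertible.self_of_nhds
  rw [H.symm.self_of_nhds u, coordChristoffel_apply_metric hinv,
    coordChristoffel_apply_metric hinv, H.fderiv_symm w v u]
  ring

lemma differentiableAt_coordChristoffel [CompleteSpace E] (H : IsMetricNear h y) (u v : E) :
    DifferentiableAt ℝ (fun z => coordChristoffel h z u v) y := by
  have hinv : DifferentiableAt ℝ (fun z => (h z).inverse) y :=
    (((H.isInvertible.self_of_nhds).contDiffAt_map_inverse (n := 1)).differentiableAt
      (by norm_num)).comp y H.differentiableAt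
  have hd : DifferentiableAt ℝ (fderiv ℝ h) y :=
    (H.contDiffAt.fderiv_right (m := 1) (by norm_num)).differentiableAt (by norm_num)
  have hc : ∀ a b, DifferentiableAt ℝ (fun z => fderiv ℝ h z a b) y := fun a b =>
    (hd.clm_apply (differentiableAt_const _)).clm_apply (differentiableAt_const _)
  have hf : DifferentiableAt ℝ (fun z => ((fderiv ℝ h z).flip u).flip v) y := by
    have h₁ : DifferentiableAt ℝ (fun z => (fderiv ℝ h z).flip u) y :=
      ((ContinuousLinearMap.flipₗᵢ ℝ E E (E →L[ℝ] ℝ)).differentiable.differentiableAt.comp y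
        hd).clm_apply (differentiableAt_const _)
    exact ((ContinuousLinearMap.flipₗᵢ ℝ E E ℝ).differentiable.differentiableAt.comp y
        h₁).clm_apply (differentiableAt_const _)
  exact hinv.clm_apply ((((hc u v).add (hc v u)).sub hf).const_smul (1 / 2 : ℝ))

lemma fderiv_metric_apply (H : IsMetricNear h y) {a b : E → E} (ha : DifferentiableAt ℝ a y)
    (hb : DifferentiableAt ℝ b y) (w : E) :
    fderiv ℝ (fun z => h z (a z) (b z)) y w =
      fderiv ℝ h y w (a y) (b y) + h y (fderiv ℝ a y w) (b y) + h y (a y) (fderiv ℝ b y w) := by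
  rw [fderiv_clm_apply (H.differentiableAt.clm_apply ha) hb, fderiv_clm_apply H.differentiableAt ha]
  simp
  ring

/-- Obtained by differentiating the compatibility identity `fderiv_metric` along `v`. The two middle
terms are together symmetric in `u`, `v`; the outer two carry the halves of the curvature that
survive antisymmetrization. -/
lemma fderiv_fderiv_metric [CompleteSpace E] (H : IsMetricNear h y) (u v a b : E) :
    fderiv ℝ (fderiv ℝ h) y v u a b =
      h y (fderiv ℝ (fun z => coordChristoffel h z u a) y v
        + coordChristoffel h y v (coordChristoffel h y u a)) b
      + h y (coordChristoffel h y u a) (coordChristoffel h y v b)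
      + h y (coordChristoffel h y v a) (coordChristoffel h y u b)
      + h y a (fderiv ℝ (fun z => coordChristoffel h z u b) y v
        + coordChristoffel h y v (coordChristoffel h y u b)) := by
  have hd : DifferentiableAt ℝ (fderiv ℝ h) y :=
    (H.contDiffAt.fderiv_right (m := 1) (by norm_num)).differentiableAt (by norm_num)
  have h₁ : fderiv ℝ (fun z => fderiv ℝ h z u a b) y v = fderiv ℝ (fderiv ℝ h) y v u a b := by
    rw [fderiv_clm_apply ((hd.clm_apply (differentiableAt_const _)).clm_apply
      (differentiableAt_const _)) (differentiableAt_const _),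
      fderiv_clm_apply (hd.clm_apply (differentiableAt_const _)) (differentiableAt_const _),
      fderiv_clm_apply hd (differentiableAt_const _)]
    simp
  have h₂ : (fun z => fderiv ℝ h z u a b) =ᶠ[nhds y] fun z =>
      h z (coordChristoffel h z u a) b + h z a (coordChristoffel h z u b) := by
    filter_upwards [H.eventually_isMetricNear] with z hz using hz.fderiv_metric u a b
  have hΓ := H.differentiableAt_coordChristoffel
  have hm : ∀ {a b : E → E}, DifferentiableAt ℝ a y → DifferentiableAt ℝ b y →
      DifferentiableAt ℝ (fun z => h z (a z) (b z)) y := fun ha hb =>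
    (H.differentiableAt.clm_apply ha).clm_apply hb
  rw [← h₁, h₂.fderiv_eq, fderiv_fun_add (hm (hΓ u a) (differentiableAt_const b))
    (hm (differentiableAt_const a) (hΓ u b)), add_apply,
    H.fderiv_metric_apply (hΓ u a) (differentiableAt_const b),
    H.fderiv_metric_apply (differentiableAt_const a) (hΓ u b), H.fderiv_metric, H.fderiv_metric]
  simp
  ring

/-- Antisymmetrizing the second derivative of the metric in `u`, `v` gives zero on one side and h(R
a, b) + h(a, R b) on the other. -/
lemma coordCurvature_skew [CompleteSpace E] (H : IsMetricNear h y) (u v a b : E) :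
    h y (coordCurvature h (fun _ => u) (fun _ => v) (fun _ => a) y) b =
      - h y a (coordCurvature h (fun _ => u) (fun _ => v) (fun _ => b) y) := by
  have hs : fderiv ℝ (fderiv ℝ h) y v u = fderiv ℝ (fderiv ℝ h) y u v :=
    H.contDiffAt.isSymmSndFDerivAt (by simp) v u
  have e := congrArg (fun B => B a b) hs
  simp only [H.fderiv_fderiv_metric] at e
  rw [coordCurvature_const, coordCurvature_const, map_sub, map_sub,
    sub_apply]
  linarith

lemma isLinearMap_fderiv_coordChristoffel_left [CompleteSpace E] (H : IsMetricNear h y)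
    (v w : E) : IsLinearMap ℝ (fun u => fderiv ℝ (fun z => coordChristoffel h z u w) y v) where
  map_add a b := by
    simp only [(isLinearMap_coordChristoffel_left h _ w).map_add]
    rw [fderiv_fun_add (H.differentiableAt_coordChristoffel a w)
      (H.differentiableAt_coordChristoffel b w)]
    rfl
  map_smul c a := by
    simp only [(isLinearMap_coordChristoffel_left h _ w).map_smul]
    rw [fderiv_fun_const_smul (H.differentiableAt_coordChristoffel a w)]
    rfl

lemma fderiv_coordChristoffel_symm (H : IsMetricNear h y) (u w : E) :
    fderiv ℝ (fun z => coordChristoffel h z u w) y =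
      fderiv ℝ (fun z => coordChristoffel h z w u) y := by
  apply Filter.EventuallyEq.fderiv_eq
  filter_upwards [H.eventually_isMetricNear] with z hz using hz.coordChristoffel_symm u w

lemma isLinearMap_coordCurvature_fst [CompleteSpace E] (H : IsMetricNear h y) (v w : E) :
    IsLinearMap ℝ
      (fun u => coordCurvature h (fun _ => u) (fun _ => v) (fun _ => w) y) where
  map_add a b := by
    simp only [coordCurvature_const, (H.isLinearMap_fderiv_coordChristoffel_left v w).map_add,
      (isLinearMap_coordChristoffel_left h y _).map_add,
      (H.isLinearMap_coordChristoffel_right _).map_add, map_add]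
    abel
  map_smul c a := by
    simp only [coordCurvature_const, (H.isLinearMap_fderiv_coordChristoffel_left v w).map_smul,
      (isLinearMap_coordChristoffel_left h y _).map_smul,
      (H.isLinearMap_coordChristoffel_right _).map_smul, map_smul, smul_add, smul_sub]

lemma isLinearMap_coordCurvature_thd [CompleteSpace E] (H : IsMetricNear h y) (u v : E) :
    IsLinearMap ℝ
      (fun w => coordCurvature h (fun _ => u) (fun _ => v) (fun _ => w) y) where
  map_add a b := by
    -- Symmetry of Γ moves `w` to the first slot, where linearity of the differentiated symbol is
    -- already known.
    simp only [coordCurvature_const, H.fderiv_coordChristoffel_symm u,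
      H.fderiv_coordChristoffel_symm v,
      (H.isLinearMap_fderiv_coordChristoffel_left _ _).map_add,
      (H.isLinearMap_coordChristoffel_right _).map_add]
    abel
  map_smul c a := by
    simp only [coordCurvature_const, H.fderiv_coordChristoffel_symm u,
      H.fderiv_coordChristoffel_symm v,
      (H.isLinearMap_fderiv_coordChristoffel_left _ _).map_smul,
      (H.isLinearMap_coordChristoffel_right _).map_smul, smul_add, smul_sub]

end IsMetricNear

/-- The curvature is antisymmetric in its first two arguments. -/
lemma coordCurvature_const_swap (h : E → E →L[ℝ] E →L[ℝ] ℝ) (u v w y : E) :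
    coordCurvature h (fun _ => u) (fun _ => v) (fun _ => w) y =
      - coordCurvature h (fun _ => v) (fun _ => u) (fun _ => w) y := by
  rw [coordCurvature_const, coordCurvature_const, neg_sub]

end Coordinates

/-! ### Transfer to the manifold through charts -/

section Manifold

variable {E : Type*} [NormedAddCommGroup E] [NormedSpace ℝ E]
  {M : Type*} [TopologicalSpace M] [ChartedSpace E M] [IsManifold 𝓘(ℝ, E) ∞ M]

/-- A bilinear form on a finite-dimensional space with trivial kernel is invertible as a map to
the dual space. -/
lemma isInvertible_of_ker_eq_bot [FiniteDimensional ℝ E] {B : E →L[ℝ] E →L[ℝ] ℝ}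
    (hB : ∀ v, B v = 0 → v = 0) :
    B.IsInvertible := by
  have hd : Module.finrank ℝ E = Module.finrank ℝ (E →L[ℝ] ℝ) := by
    rw [← (LinearMap.toContinuousLinearMap (𝕜 := ℝ) (E := E) (F' := ℝ)).finrank_eq]
    exact (Subspace.dual_finrank_eq (K := ℝ) (V := E)).symm
  have hi : Function.Injective (B : E →ₗ[ℝ] E →L[ℝ] ℝ) :=
    (injective_iff_map_eq_zero _).2 hB
  exact ⟨(LinearEquiv.ofInjectiveOfFinrankEq _ hi hd).toContinuousLinearEquiv, rfl⟩

lemma mfderiv_extChartAt_symm_isInvertible (x : M) {y : E}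
    (hy : y ∈ (extChartAt 𝓘(ℝ, E) x).target) :
    (mfderiv 𝓘(ℝ, E) 𝓘(ℝ, E) (extChartAt 𝓘(ℝ, E) x).symm y).IsInvertible := by
  have : IsManifold 𝓘(ℝ, E) 1 M := .of_le (n := ∞) (by simp)
  have := isInvertible_mfderivWithin_extChartAt_symm hy
  rwa [modelWithCornersSelf_coe, Set.range_id, mfderivWithin_univ] at this

lemma mfderiv_extChartAt_symm_apply (x : M) (v : TangentSpace 𝓘(ℝ, E) x) :
    mfderiv 𝓘(ℝ, E) 𝓘(ℝ, E) (extChartAt 𝓘(ℝ, E) x).symm (extChartAt 𝓘(ℝ, E) x x)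
      (mfderiv 𝓘(ℝ, E) 𝓘(ℝ, E) (extChartAt 𝓘(ℝ, E) x) x v) = v := by
  have : IsManifold 𝓘(ℝ, E) 1 M := .of_le (n := ∞) (by simp)
  have := mfderivWithin_extChartAt_symm_comp_mfderiv_extChartAt' (I := 𝓘(ℝ, E))
    (mem_extChartAt_source (I := 𝓘(ℝ, E)) x)
  rw [modelWithCornersSelf_coe, Set.range_id, mfderivWithin_univ] at this
  exact congrArg (fun f => f v) this

/-- Smoothness of the coordinate frame: it makes the coefficients of the metric in a chart smooth.
-/
lemma contMDiffAt_mfderiv_extChartAt_symm (x : M) {y : E}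
    (hy : y ∈ (extChartAt 𝓘(ℝ, E) x).target) (v : E) :
    ContMDiffAt 𝓘(ℝ, E) (𝓘(ℝ, E).prod 𝓘(ℝ, E)) ∞
      (fun z => Bundle.TotalSpace.mk' E (E := TangentSpace 𝓘(ℝ, E))
        ((extChartAt 𝓘(ℝ, E) x).symm z)
        (mfderiv 𝓘(ℝ, E) 𝓘(ℝ, E) (extChartAt 𝓘(ℝ, E) x).symm z v)) y := by
  have hf : ContMDiffAt 𝓘(ℝ, E) 𝓘(ℝ, E) ∞ (extChartAt 𝓘(ℝ, E) x).symm y :=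
    (contMDiffOn_extChartAt_symm x).contMDiffAt
      ((isOpen_extChartAt_target x).mem_nhds hy)
  have h1 : IsManifold 𝓘(ℝ, E) 1 M := .of_le (n := ∞) (by simp)
  have hv : ContMDiffAt 𝓘(ℝ, E) (𝓘(ℝ, E).prod 𝓘(ℝ, E)) ∞
      (fun z : E => (Bundle.TotalSpace.mk' E (E := TangentSpace 𝓘(ℝ, E) (M := E)) z v)) y :=
    contMDiffAt_vectorSpace_iff_contDiffAt.2 contDiffAt_const
  have hD := hf.mfderiv_const (m := ∞) (by simp)
  exact ContMDiffAt.clm_apply_of_inCoordinates (IB₁ := 𝓘(ℝ, E)) (IB₂ := 𝓘(ℝ, E))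
    (E₁ := TangentSpace 𝓘(ℝ, E) (M := E)) (E₂ := TangentSpace 𝓘(ℝ, E) (M := M))
    (b₁ := id) hD hv hf

namespace PseudoRiemannianMetric

variable (g : PseudoRiemannianMetric E M)

lemma contDiffAt_inChart [FiniteDimensional ℝ E] (p : M) {y : E}
    (hy : y ∈ (extChartAt 𝓘(ℝ, E) p).target) :
    ContDiffAt ℝ ∞ (g.inChart p) y := by
  have hU := isOpen_extChartAt_target (I := 𝓘(ℝ, E)) p
  refine ContDiffOn.contDiffAt ?_ (hU.mem_nhds hy)
  -- In finite dimension, smoothness of an operator-valued map can be tested on fixed vectors.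
  refine contDiffOn_clm_apply.2 fun u => contDiffOn_clm_apply.2 fun v z hz => ?_
  refine ContDiffAt.contDiffWithinAt ?_
  rw [← contMDiffAt_iff_contDiffAt]
  have hf : ContMDiffAt 𝓘(ℝ, E) 𝓘(ℝ, E) ∞ (extChartAt 𝓘(ℝ, E) p).symm z :=
    (contMDiffOn_extChartAt_symm p).contMDiffAt (hU.mem_nhds hz)
  have key := ContMDiffAt.clm_bundle_apply₂ (F₁ := E) (F₂ := E) (F₃ := ℝ)
    (E₁ := TangentSpace 𝓘(ℝ, E) (M := M)) (E₂ := TangentSpace 𝓘(ℝ, E) (M := M))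
    (E₃ := fun _ : M => ℝ) (g.contMDiff.contMDiffAt.comp z hf)
    (contMDiffAt_mfderiv_extChartAt_symm p hz u) (contMDiffAt_mfderiv_extChartAt_symm p hz v)
  -- A smooth section of the trivial line bundle is a smooth function: its fibre component.
  rw [Bundle.contMDiffAt_totalSpace] at key
  exact key.2

lemma inChart_apply (p : M) (y u v : E) :
    g.inChart p y u v = g.val ((extChartAt 𝓘(ℝ, E) p).symm y)
      (mfderiv 𝓘(ℝ, E) 𝓘(ℝ, E) (extChartAt 𝓘(ℝ, E) p).symm y u)
      (mfderiv 𝓘(ℝ, E) 𝓘(ℝ, E) (extChartAt 𝓘(ℝ, E) p).symm y v) := rfl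

lemma inChart_symm (p : M) (y u v : E) : g.inChart p y u v = g.inChart p y v u := by
  rw [inChart_apply, inChart_apply, g.symm]

/-- Nondegeneracy survives the pull-back because the derivative of the inverse chart is bijective.
-/
lemma isInvertible_inChart [FiniteDimensional ℝ E] (p : M) {y : E}
    (hy : y ∈ (extChartAt 𝓘(ℝ, E) p).target) :
    (g.inChart p y).IsInvertible := by
  refine isInvertible_of_ker_eq_bot fun v hv => ?_
  have hD := (mfderiv_extChartAt_symm_isInvertible p hy).bijective
  have h0 := g.nondegenerate _ (mfderiv 𝓘(ℝ, E) 𝓘(ℝ, E) (extChartAt 𝓘(ℝ, E) p).symm y v)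
    fun w => by
      obtain ⟨w', rfl⟩ := hD.2 w
      exact (g.inChart_apply p y v w').symm.trans (DFunLike.congr_fun hv w')
  exact hD.1 (h0.trans (map_zero _).symm)

lemma isMetricNear_inChart [FiniteDimensional ℝ E] (p : M) :
    IsMetricNear (g.inChart p) (extChartAt 𝓘(ℝ, E) p p) where
  symm := .of_forall fun z u v => g.inChart_symm p z u v
  isInvertible := by
    filter_upwards [(isOpen_extChartAt_target p).mem_nhds (mem_extChartAt_target p)] with z hz
      using g.isInvertible_inChart p hz
  contDiffAt := (g.contDiffAt_inChart p (mem_extChartAt_target p)).of_le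
    (WithTop.coe_le_coe.2 (le_top (a := (2 : ℕ∞))))

end PseudoRiemannianMetric

variable (E) in
/-- The derivative at `x` of the chart at `x`. -/
noncomputable def chartDeriv (x : M) : TangentSpace 𝓘(ℝ, E) x →L[ℝ] E :=
  mfderiv 𝓘(ℝ, E) 𝓘(ℝ, E) (extChartAt 𝓘(ℝ, E) x) x

variable (E) in
/-- The derivative of the inverse of the chart at `x`, at the image of `x`. -/
noncomputable def chartDerivSymm (x : M) : E →L[ℝ] TangentSpace 𝓘(ℝ, E) x :=
  (mfderiv 𝓘(ℝ, E) 𝓘(ℝ, E) (extChartAt 𝓘(ℝ, E) x).symm (extChartAt 𝓘(ℝ, E) x x) : E →L[ℝ] E)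

lemma chartDerivSymm_chartDeriv (x : M) (v : TangentSpace 𝓘(ℝ, E) x) :
    chartDerivSymm E x (chartDeriv E x v) = v :=
  mfderiv_extChartAt_symm_apply x v

namespace PseudoRiemannianMetric

variable (g : PseudoRiemannianMetric E M)

lemma curvature_eq (x : M) (X Y Z : TangentSpace 𝓘(ℝ, E) x) :
    g.curvature x X Y Z = chartDerivSymm E x (coordCurvature (g.inChart x)
      (fun _ => chartDeriv E x X) (fun _ => chartDeriv E x Y) (fun _ => chartDeriv E x Z)
      (extChartAt 𝓘(ℝ, E) x x)) := rfl

lemma inChart_self_apply (x : M) (u v : E) :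
    g.inChart x (extChartAt 𝓘(ℝ, E) x x) u v =
      g.val x (chartDerivSymm E x u) (chartDerivSymm E x v) := by
  -- The point φ⁻¹(φ x) equals x only propositionally. Reading both forms on the common model space
  -- `E` lets the base point be generalized and substituted.
  have h : ∀ z, z = x → ∀ u v : E, (show E →L[ℝ] E →L[ℝ] ℝ from g.val z) u v =
      (show E →L[ℝ] E →L[ℝ] ℝ from g.val x) u v := by
    rintro _ rfl _ _
    rfl
  exact h _ (extChartAt_to_inv x) _ _

lemma val_chartDerivSymm (x : M) (a : E) (V : TangentSpace 𝓘(ℝ, E) x) :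
    g.val x (chartDerivSymm E x a) V =
      g.inChart x (extChartAt 𝓘(ℝ, E) x x) a (chartDeriv E x V) := by
  rw [inChart_self_apply, chartDerivSymm_chartDeriv]

/-- `R(X, Y)` is skew-adjoint. -/
lemma curvature_skew [FiniteDimensional ℝ E] (x : M) (X Y Z V : TangentSpace 𝓘(ℝ, E) x) :
    g.val x (g.curvature x X Y Z) V = - g.val x Z (g.curvature x X Y V) := by
  have : CompleteSpace E := FiniteDimensional.complete ℝ E
  have H := g.isMetricNear_inChart x
  rw [g.symm x Z]
  simp only [curvature_eq]
  rw [val_chartDerivSymm, val_chartDerivSymm, H.coordCurvature_skew, g.inChart_symm]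

end PseudoRiemannianMetric

/-- A `(1,3)`-tensor is linear in each argument. -/
structure TensorField13.IsTrilinear (T : TensorField13 E M) : Prop where
  fst : ∀ x Y Z, IsLinearMap ℝ fun X => T x X Y Z
  snd : ∀ x X Z, IsLinearMap ℝ fun Y => T x X Y Z
  thd : ∀ x X Y, IsLinearMap ℝ fun Z => T x X Y Z

/-! ### Trilinearity of the tensors and algebra of the derivation action -/

namespace PseudoRiemannianMetric

variable (g : PseudoRiemannianMetric E M)

lemma curvature_swap (x : M) (X Y Z : TangentSpace 𝓘(ℝ, E) x) :
    g.curvature x X Y Z = - g.curvature x Y X Z := by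
  simp only [curvature_eq]
  rw [coordCurvature_const_swap, map_neg]

lemma isTrilinear_curvature [FiniteDimensional ℝ E] : g.curvature.IsTrilinear := by
  have : CompleteSpace E := FiniteDimensional.complete ℝ E
  have h₁ : ∀ x Y Z, IsLinearMap ℝ fun X => g.curvature x X Y Z := fun x Y Z => by
    have H := (g.isMetricNear_inChart x).isLinearMap_coordCurvature_fst
    constructor
    · intro a b
      simp only [curvature_eq]
      rw [map_add, (H _ _).map_add, map_add]
    · intro c a
      simp only [curvature_eq]
      rw [map_smul, (H _ _).map_smul, map_smul]
  refine ⟨h₁, fun x X Z => ?_, fun x X Y => ?_⟩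
  · constructor
    · intro a b
      rw [g.curvature_swap, (h₁ _ _ _).map_add, neg_add, ← g.curvature_swap, ← g.curvature_swap]
    · intro c a
      rw [g.curvature_swap, (h₁ _ _ _).map_smul, ← smul_neg, ← g.curvature_swap]
  · have H := (g.isMetricNear_inChart x).isLinearMap_coordCurvature_thd
    constructor
    · intro a b
      simp only [curvature_eq]
      rw [map_add, (H _ _).map_add, map_add]
    · intro c a
      simp only [curvature_eq]
      rw [map_smul, (H _ _).map_smul, map_smul]

lemma isTrilinear_G : g.G.IsTrilinear where
  fst x Y Z := ⟨fun a b => by simp only [G, map_add, add_apply]; module,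
    fun c a => by simp only [G, map_smul, smul_apply, smul_eq_mul]; module⟩
  snd x Y Z := ⟨fun a b => by simp only [G, map_add, add_apply]; module,
    fun c a => by simp only [G, map_smul, smul_apply, smul_eq_mul]; module⟩
  thd x Y Z := ⟨fun a b => by simp only [G, map_add]; module,
    fun c a => by simp only [G, map_smul, smul_eq_mul]; module⟩

lemma G_skew (x : M) (X Y Z V : TangentSpace 𝓘(ℝ, E) x) :
    g.val x (g.G x X Y Z) V = - g.val x Z (g.G x X Y V) := by
  simp only [G, map_sub, map_smul, sub_apply, smul_apply, smul_eq_mul]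
  rw [g.symm x Z Y, g.symm x Z X]
  ring

/-- A skew-adjoint linear operator annihilates `G`. -/
lemma derivAction_G_eq_zero {A : TensorField13 E M}
    (hlin : ∀ x X Y, IsLinearMap ℝ fun Z => A x X Y Z)
    (hskew : ∀ x X Y Z V, g.val x (A x X Y Z) V = - g.val x Z (A x X Y V)) :
    derivAction A g.G = 0 := by
  funext x X Y U V W
  -- The terms containing AU or AV as vectors cancel by linearity; the remaining coefficients g(AU,
  -- W) + g(U, AW) and g(AV, W) + g(V, AW) vanish by skewness.
  simp only [derivAction, G, (hlin x X Y).map_sub, (hlin x X Y).map_smul, hskew x X Y U,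
    hskew x X Y V, Pi.zero_apply]
  module

/-- Linearity in the acting tensor needs `T` trilinear, since the endomorphism also acts inside each
slot of `T`. -/
lemma derivAction_concircular_left [FiniteDimensional ℝ E] {T : TensorField13 E M}
    (hT : T.IsTrilinear) (x : M) :
    derivAction g.concircular T x =
      derivAction g.curvature T x - g.kappa x • derivAction g.G T x := by
  funext X Y U V W
  simp only [derivAction, concircular, Pi.sub_apply, Pi.smul_apply, (hT.fst x _ _).map_sub,
    (hT.fst x _ _).map_smul, (hT.snd x _ _).map_sub, (hT.snd x _ _).map_smul,
    (hT.thd x _ _).map_sub, (hT.thd x _ _).map_smul]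
  module

/-- Here only linearity of the endomorphism A(X, Y) matters; κ(x) passes through it as a constant,
since the action is pointwise. -/
lemma derivAction_concircular_right [FiniteDimensional ℝ E] {A : TensorField13 E M}
    (hlin : ∀ x X Y, IsLinearMap ℝ fun Z => A x X Y Z) (x : M) :
    derivAction A g.concircular x =
      derivAction A g.curvature x - g.kappa x • derivAction A g.G x := by
  funext X Y U V W
  simp only [derivAction, concircular, Pi.sub_apply, Pi.smul_apply, (hlin x _ _).map_sub,
    (hlin x _ _).map_smul]
  module

lemma derivAction_curvature_concircular [FiniteDimensional ℝ E] :
    derivAction g.curvature g.concircular = derivAction g.curvature g.curvature := by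
  funext x
  rw [g.derivAction_concircular_right g.isTrilinear_curvature.thd,
    g.derivAction_G_eq_zero g.isTrilinear_curvature.thd g.curvature_skew]
  simp

lemma isTrilinear_concircular [FiniteDimensional ℝ E] : g.concircular.IsTrilinear := by
  have hR := g.isTrilinear_curvature
  have hG := g.isTrilinear_G
  refine ⟨fun x Y Z => ⟨fun a b => ?_, fun c a => ?_⟩, fun x X Z => ⟨fun a b => ?_, fun c a => ?_⟩,
    fun x X Y => ⟨fun a b => ?_, fun c a => ?_⟩⟩ <;> simp only [concircular]
  · rw [(hR.fst _ _ _).map_add, (hG.fst _ _ _).map_add]; module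
  · rw [(hR.fst _ _ _).map_smul, (hG.fst _ _ _).map_smul]; module
  · rw [(hR.snd _ _ _).map_add, (hG.snd _ _ _).map_add]; module
  · rw [(hR.snd _ _ _).map_smul, (hG.snd _ _ _).map_smul]; module
  · rw [(hR.thd _ _ _).map_add, (hG.thd _ _ _).map_add]; module
  · rw [(hR.thd _ _ _).map_smul, (hG.thd _ _ _).map_smul]; module

lemma derivAction_concircular_concircular [FiniteDimensional ℝ E] :
    derivAction g.concircular g.concircular = derivAction g.concircular g.curvature := by
  funext x
  -- Skew-adjoint operators form a linear space, so C(X, Y) inherits skewness from R(X, Y) and G(X,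
  -- Y).
  have hs : ∀ x X Y Z V, g.val x (g.concircular x X Y Z) V = - g.val x Z (g.concircular x X Y V) :=
    fun x X Y Z V => by
      simp only [concircular, map_sub, map_smul, sub_apply, smul_apply, smul_eq_mul]
      rw [g.curvature_skew, g.G_skew]
      ring
  rw [g.derivAction_concircular_right g.isTrilinear_concircular.thd,
    g.derivAction_G_eq_zero g.isTrilinear_concircular.thd hs]
  simp

/-- This is only the expansion C · R = R · R - κ G · R; skewness plays no part. -/
lemma isPseudoSymmetric_iff [FiniteDimensional ℝ E] :
    g.IsPseudoSymmetric ↔ derivAction g.concircular g.curvature = 0 := by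
  rw [IsPseudoSymmetric, funext_iff]
  refine forall_congr' fun x => ?_
  rw [g.derivAction_concircular_left g.isTrilinear_curvature, Pi.zero_apply, sub_eq_zero]

end PseudoRiemannianMetric

end Manifold

theorem mainTheorem12
    {E : Type*} [NormedAddCommGroup E] [NormedSpace ℝ E] [FiniteDimensional ℝ E]
    {M : Type*} [TopologicalSpace M] [ChartedSpace E M] [IsManifold 𝓘(ℝ, E) ∞ M]
    (hn : 3 ≤ Module.finrank ℝ E) (g : PseudoRiemannianMetric E M) :
    (g.IsPseudoSymmetric ↔ derivAction g.concircular g.concircular = 0) ∧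
    (g.IsConcircularSemiSymmetric ↔ g.IsSemiSymmetric) ∧
    (g.IsPseudoSymmetric ↔ derivAction g.concircular g.curvature = 0) := by
  refine ⟨?_, ?_, g.isPseudoSymmetric_iff⟩
  · rw [g.derivAction_concircular_concircular, g.isPseudoSymmetric_iff]
  · rw [PseudoRiemannianMetric.IsConcircularSemiSymmetric,
      PseudoRiemannianMetric.IsSemiSymmetric, g.derivAction_curvature_concircular]
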